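/- **Setting.** Let $L\ge 0$ and let $\sigma_\ell,c_\ell,\lambda_\ell>0$ for $1\le \ell\le L$; put $\Lambda_\ell=\prod_{k=1}^{\ell}\lambda_k$ and $$P(m)=(m+1)\prod_{\ell=1}^{L}\sigma_\ell^2\,(c_\ell+\Lambda_\ell m),\qquad Q(m)=m,\qquad f(m)=\frac{P(m)}{Q(m)} .$$ (This is the master equation for the limiting squared singular values of the input-output Jacobian of an $L$-layer network with i.i.d. weights of variance parameters $\sigma_\ell^2$, width ratios $\lambda_\ell$, and ReLU, Hard Tanh, Hard Sine or linear non-linearities, which determine the $c_\ell$.) Let $\nu$ be a probability measure on $[0,\infty)$ with moment generating function $$M(z)=z\int\frac{\nu(dv)}{z-v}-1,$$ and suppose that $f=M^{\langle -1\rangle}$ near $0$, i.e. $M(f(m))=m$ for all sufficiently small $m\ne0$. Write $\mathbb C_+=\{\operatorname{Im} z>0\}$ and, for $z\in\mathbb C_+$, $\varphi_z(m)=P(m)/z-Q(m)$. **Newton–Raphson.** $\mathrm{newton}(z,m_0)$ is the limit of the iteration $m\leftarrow m-\varphi_z(m)/\varphi_z'(m)$ started at $m_0$; it is defined if $\varphi_z'\neq0$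 at every iterate and the iterates converge. **Kantorovich criterion.** $\mathrm{basin}(z,m_0)$ holds if $\varphi_z'(m_0)\neq 0$ and, with $\delta=|\varphi_z(m_0)/\varphi_z'(m_0)|$ and $\kappa=|1/\varphi_z'(m_0)|$, there is a number $h<\tfrac12$ such that $$h=\delta\kappa\lambda,\qquad \lambda=\sup_{|m-m_0|\le t^*}|\varphi_z''(m)|,\qquad t^*=\frac{2\delta}{1+\sqrt{1-2h}} .$$ **Algorithm (Newton lilypads)** with input $z_{\mathrm{obj}}\in\mathbb C_+$: 1. Set $z\leftarrow z_{\mathrm{obj}}$; while $\mathrm{basin}(z,0)$ fails, set $z\leftarrow z+i\operatorname{Im}z$ (doubling the imaginary part). Then set $m\leftarrow\mathrm{newton}(z,0)$. 2. While $z\neq z_{\mathrm{obj}}$: set $\Delta z\leftarrow z_{\mathrm{obj}}-z$; while $\mathrm{basin}(z+\Delta z,m)$ fails, set $\Delta z\leftarrow\Delta z/2$; then set $z\leftarrow z+\Delta z$ and $m\leftarrow\mathrm{newton}(z,m)$. 3. Return $m$. **Theorem.** For every $z\in\mathbb C_+$, the algorithm with input $z_{\mathrm{obj}}=z$ has guaranteed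 convergence: each of its loops stops after finitely many steps, every call of Newton–Raphson is defined (it never divides by zero and converges), and the returned value is $M(z)$. Moreover $M$ is the unique holomorphic extension to $\mathbb C_+$ of the inverse of $f$ near $0$: $M$ is holomorphic on $\mathbb C_+$ with $M(f(m))=m$ for all small $m\ne0$ with $f(m)\in\mathbb C_+$, and every holomorphic function $g$ on $\mathbb C_+$ such that $g(f(m))=m$ for all small $m\neq0$ with $f(m)\in\mathbb C_+$ equals $M$ on $\mathbb C_+$. -/

import Mathlib

open MeasureTheory Filter Topology Polynomial

/-! ### Transforms of a probability measure on the half-line -/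

/-- The open upper half-plane, as a set of complex numbers. -/
def upperHalf : Set ℂ := {z | 0 < z.im}

/-- Cauchy-Stieltjes transform `G(z) = ∫ ν(dv) / (z - v)`. -/
noncomputable def cauchyTransform (ν : Measure ℝ) (z : ℂ) : ℂ :=
  ∫ v : ℝ, (z - (v : ℂ))⁻¹ ∂ν

/-- Moment generating function `M(z) = z G(z) - 1`, which is `∑ m_k / z ^ k` near infinity. -/
noncomputable def momentGen (ν : Measure ℝ) (z : ℂ) : ℂ :=
  z * cauchyTransform ν z - 1

/-- `f` is the inverse of `M` near `0`: `M (f m) = m` for all small `m ≠ 0`.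
(It is used for functions `f` that tend to infinity at `0`, so that this is the inverse of the
germ of `M` at infinity.) -/
def IsMomentGenInverse (ν : Measure ℝ) (f : ℂ → ℂ) : Prop :=
  ∀ᶠ m in 𝓝[≠] (0 : ℂ), momentGen ν (f m) = m

/-- `g` is holomorphic on the upper half-plane and inverts there the restriction of `f` to a
punctured neighbourhood of `0`. -/
def IsHolomorphicInverse (f g : ℂ → ℂ) : Prop :=
  DifferentiableOn ℂ g upperHalf ∧
    ∀ᶠ m in 𝓝[≠] (0 : ℂ), f m ∈ upperHalf → g (f m) = m

/-! ### The master equation -/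

/-- Limiting width ratios `Λ_ℓ = λ_1 ⋯ λ_ℓ`. -/
def widthRatio {L : ℕ} (lam : Fin L → ℝ) (l : Fin L) : ℝ :=
  ∏ k ∈ Finset.Iic l, lam k

/-- The rational function `(m + 1) / m * ∏ σ_ℓ² (c_ℓ + Λ_ℓ m)`. -/
noncomputable def masterFun {L : ℕ} (σ c lam : Fin L → ℝ) (m : ℂ) : ℂ :=
  (m + 1) / m * ∏ l, (σ l : ℂ) ^ 2 * ((c l : ℂ) + (widthRatio lam l : ℂ) * m)

/-- The numerator `P` of `masterFun`; its denominator is `Q = X`. -/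
noncomputable def masterNum {L : ℕ} (σ c lam : Fin L → ℝ) : ℂ[X] :=
  (X + 1) * ∏ l, C ((σ l : ℂ) ^ 2) * (C (c l : ℂ) + C (widthRatio lam l : ℂ) * X)

theorem masterFun_eq {L : ℕ} (σ c lam : Fin L → ℝ) (m : ℂ) :
    masterFun σ c lam m = (masterNum σ c lam).eval m / (X : ℂ[X]).eval m := by
  simp only [masterFun, masterNum, eval_mul, eval_add, eval_X, eval_one, eval_prod, eval_C]
  ring

/-! ### Newton-Raphson and the Kantorovich criterion -/

/-- The polynomial `φ_z = P / z - Q`. -/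
noncomputable def phiPoly (P Q : ℂ[X]) (z : ℂ) : ℂ[X] := C z⁻¹ * P - Q

/-- One Newton-Raphson step for the polynomial `p`. -/
noncomputable def newtonStep (p : ℂ[X]) (m : ℂ) : ℂ :=
  m - p.eval m / p.derivative.eval m

/-- The Newton-Raphson scheme for `p` with initial guess `m₀` never divides by zero, and it
converges to `m` (which is then a zero of `p`). -/
def NewtonReturns (p : ℂ[X]) (m₀ m : ℂ) : Prop :=
  (∀ n : ℕ, p.derivative.eval ((newtonStep p)^[n] m₀) ≠ 0) ∧
    Tendsto (fun n : ℕ => (newtonStep p)^[n] m₀) atTop (𝓝 m)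

/-- `δ = |p(m₀) / p'(m₀)|`. -/
noncomputable def kantDelta (p : ℂ[X]) (m₀ : ℂ) : ℝ :=
  ‖p.eval m₀ / p.derivative.eval m₀‖

/-- `κ = |1 / p'(m₀)|`. -/
noncomputable def kantKappa (p : ℂ[X]) (m₀ : ℂ) : ℝ :=
  ‖1 / p.derivative.eval m₀‖

/-- The radius `t* = 2 δ / (1 + √(1 - 2 h))`. -/
noncomputable def kantRadius (p : ℂ[X]) (m₀ : ℂ) (h : ℝ) : ℝ :=
  2 * kantDelta p m₀ / (1 + √(1 - 2 * h))

/-- `λ`, the supremum of `|p''|` over the closed disc of centre `m₀` and radius `t`. -/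
noncomputable def kantLambda (p : ℂ[X]) (m₀ : ℂ) (t : ℝ) : ℝ :=
  sSup ((fun m : ℂ => ‖p.derivative.derivative.eval m‖) '' Metric.closedBall m₀ t)

/-- The Kantorovich criterion at `m₀`: `p'(m₀) ≠ 0` and `h = δ κ λ < 1 / 2`, where `λ` is taken
over the disc of radius `t*`. As `t*` depends on `h`, the number `h` is a solution of this
equation. -/
def IsInBasin (p : ℂ[X]) (m₀ : ℂ) : Prop :=
  p.derivative.eval m₀ ≠ 0 ∧
    ∃ h : ℝ, h = kantDelta p m₀ * kantKappa p m₀ * kantLambda p m₀ (kantRadius p m₀ h) ∧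
      h < 1 / 2

/-! ### The algorithm

Each loop is given by its big-step semantics: the relation holds between the values of the
variables at the entry of the loop and those at its exit, so that it holds only for runs that
terminate. -/

/-- `while not is_in_basin(z, 0): z ← z + i Im z`. -/
inductive DoublingLoop (P Q : ℂ[X]) : ℂ → ℂ → Prop
  | exit (z : ℂ) : IsInBasin (phiPoly P Q z) 0 → DoublingLoop P Q z z
  | next (z z' : ℂ) : ¬ IsInBasin (phiPoly P Q z) 0 →
      DoublingLoop P Q (z + Complex.I * (z.im : ℂ)) z' → DoublingLoop P Q z z'

/-- `while not is_in_basin(z + Δz, m): Δz ← Δz / 2`. -/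
inductive HalvingLoop (P Q : ℂ[X]) (z m : ℂ) : ℂ → ℂ → Prop
  | exit (dz : ℂ) : IsInBasin (phiPoly P Q (z + dz)) m → HalvingLoop P Q z m dz dz
  | next (dz dz' : ℂ) : ¬ IsInBasin (phiPoly P Q (z + dz)) m →
      HalvingLoop P Q z m (dz / 2) dz' → HalvingLoop P Q z m dz dz'

/-- The main loop: while `z ≠ zobj`, put `Δz ← zobj - z`, run the halving loop on `Δz`, and put
`z ← z + Δz`, `m ← newton_raphson(z, guess = m)`. The last argument is the returned `m`. -/
inductive DichotomyLoop (P Q : ℂ[X]) (zobj : ℂ) : ℂ → ℂ → ℂ → Prop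
  | exit (m : ℂ) : DichotomyLoop P Q zobj zobj m m
  | next (z m dz m' out : ℂ) : z ≠ zobj → HalvingLoop P Q z m (zobj - z) dz →
      NewtonReturns (phiPoly P Q (z + dz)) m m' →
      DichotomyLoop P Q zobj (z + dz) m' out → DichotomyLoop P Q zobj z m out

/-- `NewtonLilypads P Q zobj proxy out`: on the input `zobj` with the optional proxy `(z₀, m₀)`,
the algorithm for `f = P / Q` terminates and returns `out`. -/
def NewtonLilypads (P Q : ℂ[X]) (zobj : ℂ) : Option (ℂ × ℂ) → ℂ → Prop
  | none, out => ∃ z m : ℂ, DoublingLoop P Q zobj z ∧ NewtonReturns (phiPoly P Q z) 0 m ∧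
      DichotomyLoop P Q zobj z m out
  | some (z₀, m₀), out => DichotomyLoop P Q zobj z₀ m₀ out

/-! ### Newton's method for complex polynomials -/

/-! By the identity theorem, `P (M z) = z * M z` on the whole half-plane, so `M z` is always a root
of `φ_z`. The Kantorovich criterion makes Newton's method converge to a root in a disc where the
root is unique; what has to be shown is that this root is `M z` and not another sheet, and that the
loops stop.

Both rest on one estimate. Differentiating the equation gives `(P'(M) - z) M' = M`, and positivity
of `ν` gives `Im z * |M'| ≤ |M|`; hence `|P'(M z) - z| ≥ Im z`. No branch point is met, and Newton's
denominator is bounded below in terms of the height alone.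

For the sheet, all moves are vertical. `M` is followed continuously along a vertical segment ending
at the new point, and Kantorovich's quadratic inequality is shown to be strict before the end, so
that no root lies on the boundary circle and `M` cannot leave the disc (`norm_sub_le_of_path`). This
yields `newtonReturns_zero`, starting from height infinity where `M` tends to `0`, and
`newtonReturns_vertical`, starting from the previous point.

For termination, high points satisfy the criterion at `0` (`exists_doublingLoop`), and steps below a
length uniform over the run are accepted (`exists_step`), so each pass of the main loop reaches the
target or descends by a fixed amount. -/

theorem norm_eval_derivative_sub_le (p : ℂ[X]) {c x y : ℂ} {R S : ℝ}
    (hS : ∀ m ∈ Metric.closedBall c R, ‖p.derivative.derivative.eval m‖ ≤ S)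
    (hx : x ∈ Metric.closedBall c R) (hy : y ∈ Metric.closedBall c R) :
    ‖p.derivative.eval y - p.derivative.eval x‖ ≤ S * ‖y - x‖ :=
  (convex_closedBall c R).norm_image_sub_le_of_norm_hasDerivWithin_le
    (fun m _ => (p.derivative.hasDerivAt m).hasDerivWithinAt) hS hx hy

theorem norm_eval_sub_linear_le (p : ℂ[X]) {c x y : ℂ} {R S : ℝ}
    (hS : ∀ m ∈ Metric.closedBall c R, ‖p.derivative.derivative.eval m‖ ≤ S)
    (hx : x ∈ Metric.closedBall c R) (hy : y ∈ Metric.closedBall c R) :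
    ‖p.eval y - p.eval x - p.derivative.eval x * (y - x)‖ ≤ S / 2 * ‖y - x‖ ^ 2 := by
  have hγ : ∀ s : ℝ, HasDerivAt (fun s : ℝ => x + (s : ℂ) * (y - x)) (y - x) s := fun s => by
    simpa using ((Complex.ofRealCLM.hasDerivAt (x := s)).mul_const (y - x)).const_add x
  have hf : ∀ s : ℝ, HasDerivAt (fun s : ℝ => p.eval (x + (s : ℂ) * (y - x)) - p.eval x -
      p.derivative.eval x * (x + (s : ℂ) * (y - x) - x))
      (p.derivative.eval (x + (s : ℂ) * (y - x)) * (y - x) - p.derivative.eval x * (y - x)) s :=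
    fun s => (((p.hasDerivAt _).comp s (hγ s)).sub_const _).sub
      (((hγ s).sub_const x).const_mul _)
  have hB : ∀ s : ℝ, HasDerivAt (fun s : ℝ => S / 2 * ‖y - x‖ ^ 2 * s ^ 2)
      (S * ‖y - x‖ ^ 2 * s) s := fun s => by
    refine ((hasDerivAt_pow 2 s).const_mul _).congr_deriv ?_
    norm_num
    ring
  -- Comparing derivatives along the segment, rather than applying the mean value inequality, keeps
  -- the factor `1 / 2`.
  have key := image_norm_le_of_norm_deriv_right_le_deriv_boundary (a := 0) (b := 1)
    (fun s _ => (hf s).continuousAt.continuousWithinAt)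
    (fun s _ => (hf s).hasDerivWithinAt) (by simp) hB (fun s hs => by
      have hm : x + (s : ℂ) * (y - x) ∈ Metric.closedBall c R := by
        have := (convex_closedBall c R).add_smul_sub_mem hx hy ⟨hs.1, hs.2.le⟩
        simpa using this
      have h1 := norm_eval_derivative_sub_le p hS hx hm
      rw [← sub_mul, norm_mul]
      have h2 : ‖x + (s : ℂ) * (y - x) - x‖ = s * ‖y - x‖ := by
        rw [add_sub_cancel_left, norm_mul, Complex.norm_real, Real.norm_of_nonneg hs.1]
      rw [h2] at h1
      calc _ ≤ S * (s * ‖y - x‖) * ‖y - x‖ := by gcongr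
        _ = _ := by ring) (x := 1) (by simp)
  simpa using key

/-- A polynomial has at most one root in a disc where its derivative varies little. -/
theorem root_unique_of_mul_lt (p : ℂ[X]) {c x y : ℂ} {R S : ℝ}
    (hS : ∀ m ∈ Metric.closedBall c R, ‖p.derivative.derivative.eval m‖ ≤ S)
    (hSR : S * R < ‖p.derivative.eval c‖)
    (hx : x ∈ Metric.closedBall c R) (hy : y ∈ Metric.closedBall c R)
    (hpx : p.eval x = 0) (hpy : p.eval y = 0) : x = y := by
  by_contra hne
  have hR : 0 ≤ R := dist_nonneg.trans hx
  have hc : c ∈ Metric.closedBall c R := Metric.mem_closedBall_self hR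
  have hS0 : 0 ≤ S := (norm_nonneg _).trans (hS c hc)
  have key := (convex_closedBall c R).norm_image_sub_le_of_norm_hasDerivWithin_le
    (f := fun m => p.eval m - p.derivative.eval c * m)
    (f' := fun m => p.derivative.eval m - p.derivative.eval c) (C := S * R)
    (fun m _ => ((p.hasDerivAt m).sub
      (by simpa using (hasDerivAt_id m).const_mul _)).hasDerivWithinAt)
    (fun m hm => (norm_eval_derivative_sub_le p hS hc hm).trans
      (by gcongr; simpa [dist_eq_norm] using hm)) hy hx
  have h2 : p.eval x - p.derivative.eval c * x - (p.eval y - p.derivative.eval c * y) =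
      - (p.derivative.eval c * (x - y)) := by rw [hpx, hpy]; ring
  simp only [h2, norm_neg, norm_mul] at key
  have := norm_pos_iff.2 (sub_ne_zero.2 hne)
  exact absurd (le_of_mul_le_mul_right key this) (not_le.2 hSR)

/-- Kantorovich: if the quadratic `S t² / 2 - a t + b`, where `a = |p'(c)|` and `b = |p(c)|`,
vanishes at `R` before its minimum, and `S` bounds `|p''|` on the disc of radius `R`, then
Newton's method started at the centre converges to a root in the disc. -/
theorem exists_newtonReturns (p : ℂ[X]) {c : ℂ} {R S : ℝ} (hR : 0 ≤ R)
    (hS : ∀ m ∈ Metric.closedBall c R, ‖p.derivative.derivative.eval m‖ ≤ S)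
    (hSR : S * R < ‖p.derivative.eval c‖)
    (hq : S / 2 * R ^ 2 - ‖p.derivative.eval c‖ * R + ‖p.eval c‖ = 0) :
    ∃ m ∈ Metric.closedBall c R, p.eval m = 0 ∧ NewtonReturns p c m := by
  set a := ‖p.derivative.eval c‖ with ha
  set b := ‖p.eval c‖ with hb
  have hc : c ∈ Metric.closedBall c R := Metric.mem_closedBall_self hR
  have hS0 : 0 ≤ S := (norm_nonneg _).trans (hS c hc)
  -- Newton iterates from `0` of the real majorant quadratic `q`. They stay below its root `R`, and
  -- their increments dominate those of the complex iterates.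
  let t : ℕ → ℝ := fun n => (fun t => t + (S / 2 * t ^ 2 - a * t + b) / (a - S * t))^[n] 0
  let x : ℕ → ℂ := fun n => (newtonStep p)^[n] c
  have ht : ∀ n, t (n + 1) = t n + (S / 2 * t n ^ 2 - a * t n + b) / (a - S * t n) :=
    fun n => Function.iterate_succ_apply' _ n 0
  have hx : ∀ n, x (n + 1) = x n - p.eval (x n) / p.derivative.eval (x n) :=
    fun n => Function.iterate_succ_apply' _ n c
  have hder : ∀ m ∈ Metric.closedBall c R, a - S * ‖m - c‖ ≤ ‖p.derivative.eval m‖ := by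
    intro m hm
    have h1 := norm_eval_derivative_sub_le p hS hm hc
    have h2 := norm_sub_norm_le (p.derivative.eval c) (p.derivative.eval m)
    rw [norm_sub_rev c m] at h1
    linarith
  have hpos : ∀ r ≤ R, 0 < a - S * r := fun r hr => by
    have := mul_le_mul_of_nonneg_left hr hS0
    linarith
  have hx1 : ∀ n, x (n + 1) - x n = - (p.eval (x n) / p.derivative.eval (x n)) :=
    fun n => by rw [hx]; ring
  have inv : ∀ n, t n ≤ R ∧ ‖x n - c‖ ≤ t n ∧
      ‖p.eval (x n)‖ ≤ S / 2 * t n ^ 2 - a * t n + b ∧ ‖x (n + 1) - x n‖ ≤ t (n + 1) - t n := by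
    have step : ∀ n, t n ≤ R → ‖x n - c‖ ≤ t n →
        ‖p.eval (x n)‖ ≤ S / 2 * t n ^ 2 - a * t n + b →
        ‖x (n + 1) - x n‖ ≤ t (n + 1) - t n := by
      intro n h1 h2 h3
      have hm : x n ∈ Metric.closedBall c R := by
        rw [Metric.mem_closedBall, dist_eq_norm]; exact h2.trans h1
      have h4 := hder _ hm
      have h5 := mul_le_mul_of_nonneg_left h2 hS0
      rw [hx1, norm_neg, norm_div, ht, add_sub_cancel_left]
      exact div_le_div₀ ((norm_nonneg _).trans h3) h3 (hpos _ h1) (by linarith)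
    intro n
    induction n with
    | zero =>
      have h1 : t 0 = 0 := rfl
      have h2 : x 0 = c := rfl
      have h3 : ‖p.eval (x 0)‖ ≤ S / 2 * t 0 ^ 2 - a * t 0 + b := by rw [h1, h2]; simp [hb]
      have h4 : ‖x 0 - c‖ ≤ t 0 := by rw [h1, h2]; simp
      exact ⟨hR, h4, h3, step 0 hR h4 h3⟩
    | succ n ih =>
      obtain ⟨h1, h2, h3, h4⟩ := ih
      have hp := hpos _ h1
      -- Exact expansion of `q` at `t n`, evaluated at its root `R`.
      have e1 : R - t (n + 1) = S / 2 * (R - t n) ^ 2 / (a - S * t n) := by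
        have := hp.ne'
        rw [ht, eq_div_iff this, sub_mul, add_mul, div_mul_cancel₀ _ this]
        linear_combination -hq
      have h1' : t (n + 1) ≤ R := by
        have : 0 ≤ R - t (n + 1) := by rw [e1]; positivity
        linarith
      have h2' : ‖x (n + 1) - c‖ ≤ t (n + 1) := by
        have := norm_add_le (x (n + 1) - x n) (x n - c)
        rw [sub_add_sub_cancel] at this
        linarith
      have hm : x n ∈ Metric.closedBall c R := by
        rw [Metric.mem_closedBall, dist_eq_norm]; exact h2.trans h1
      have hm' : x (n + 1) ∈ Metric.closedBall c R := by
        rw [Metric.mem_closedBall, dist_eq_norm]; exact h2'.trans h1'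
      have hne : p.derivative.eval (x n) ≠ 0 := by
        have h5 := mul_le_mul_of_nonneg_left h2 hS0
        exact norm_pos_iff.1 (lt_of_lt_of_le (by linarith) (hder _ hm))
      have h3' : ‖p.eval (x (n + 1))‖ ≤ S / 2 * t (n + 1) ^ 2 - a * t (n + 1) + b := by
        have h6 := norm_eval_sub_linear_le p hS hm hm'
        have h7 : p.eval (x (n + 1)) - p.eval (x n) -
            p.derivative.eval (x n) * (x (n + 1) - x n) = p.eval (x (n + 1)) := by
          rw [hx1]; field_simp; ring
        rw [h7] at h6
        -- A Newton step cancels the linear part, for `p` as for `q`: only second-order terms remain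
        -- to be compared.
        have h8 : S / 2 * t (n + 1) ^ 2 - a * t (n + 1) + b =
            S / 2 * (t (n + 1) - t n) ^ 2 := by
          rw [ht]; field_simp; ring
        rw [h8]
        exact h6.trans (by gcongr)
      exact ⟨h1', h2', h3', step _ h1' h2' h3'⟩
  have hmem : ∀ n, x n ∈ Metric.closedBall c R := fun n => by
    rw [Metric.mem_closedBall, dist_eq_norm]; exact (inv n).2.1.trans (inv n).1
  have hdne : ∀ m ∈ Metric.closedBall c R, p.derivative.eval m ≠ 0 := fun m hm =>
    norm_pos_iff.1 ((hpos _ (by simpa [dist_eq_norm] using hm)).trans_le (hder m hm))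
  have hsum : Summable fun n => t (n + 1) - t n := by
    refine summable_of_sum_range_le (c := R) (fun n => (norm_nonneg _).trans (inv n).2.2.2)
      fun n => ?_
    rw [Finset.sum_range_sub]
    simpa [t] using (inv n).1
  have hcau : CauchySeq x := cauchySeq_of_dist_le_of_summable _
    (fun n => by rw [dist_comm, dist_eq_norm]; exact (inv n).2.2.2) hsum
  obtain ⟨m, hm⟩ := cauchySeq_tendsto_of_complete hcau
  have hmB : m ∈ Metric.closedBall c R :=
    Metric.isClosed_closedBall.mem_of_tendsto hm (Eventually.of_forall hmem)
  have hroot : p.eval m = 0 := by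
    have h1 : Tendsto (fun n => x (n + 1)) atTop
        (𝓝 (m - p.eval m / p.derivative.eval m)) := by
      simp only [hx]
      exact hm.sub (((p.continuous.tendsto m).comp hm).div
        ((p.derivative.continuous.tendsto m).comp hm) (hdne m hmB))
    have h2 := tendsto_nhds_unique h1 ((tendsto_add_atTop_iff_nat 1).2 hm)
    have h3 : p.eval m / p.derivative.eval m = 0 := by linear_combination -h2
    exact (div_eq_zero_iff.1 h3).resolve_right (hdne m hmB)
  exact ⟨m, hmB, hroot, fun n => hdne _ (hmem n), hm⟩

/-! ### The Kantorovich criterion -/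

theorem bddAbove_norm_eval_closedBall (p : ℂ[X]) (c : ℂ) (R : ℝ) :
    BddAbove ((fun m : ℂ => ‖p.eval m‖) '' Metric.closedBall c R) :=
  ((isCompact_closedBall c R).image p.continuous.norm).bddAbove

theorem norm_eval_le_kantLambda (p : ℂ[X]) {c m : ℂ} {R : ℝ} (hm : m ∈ Metric.closedBall c R) :
    ‖p.derivative.derivative.eval m‖ ≤ kantLambda p c R :=
  le_csSup (bddAbove_norm_eval_closedBall p.derivative.derivative c R) ⟨m, hm, rfl⟩

theorem kantLambda_nonneg (p : ℂ[X]) (c : ℂ) (R : ℝ) : 0 ≤ kantLambda p c R :=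
  Real.sSup_nonneg (by rintro _ ⟨m, _, rfl⟩; exact norm_nonneg _)

theorem kantLambda_mono (p : ℂ[X]) (c : ℂ) {R R' : ℝ} (hR : 0 ≤ R) (h : R ≤ R') :
    kantLambda p c R ≤ kantLambda p c R' :=
  csSup_le_csSup (bddAbove_norm_eval_closedBall p.derivative.derivative c R')
    ((Metric.nonempty_closedBall.2 hR).image _)
    (Set.image_mono (Metric.closedBall_subset_closedBall h))

/-- With `a = |p'(c)|` and `b = |p(c)|`, the criterion says `h = b S / a²`, and `t*` is the smaller
root of `S t² / 2 - a t + b`, where `S t* = a (1 - √(1 - 2 h)) < a`. -/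
theorem IsInBasin.exists_radius {p : ℂ[X]} {c : ℂ} (h : IsInBasin p c) :
    ∃ S R : ℝ, 0 ≤ R ∧ (∀ m ∈ Metric.closedBall c R, ‖p.derivative.derivative.eval m‖ ≤ S) ∧
      S * R < ‖p.derivative.eval c‖ ∧
      S / 2 * R ^ 2 - ‖p.derivative.eval c‖ * R + ‖p.eval c‖ = 0 := by
  obtain ⟨hne, h, heq, hlt⟩ := h
  have ha : 0 < ‖p.derivative.eval c‖ := norm_pos_iff.2 hne
  set S := kantLambda p c (kantRadius p c h) with hSdef
  have hr0 : 0 < √(1 - 2 * h) := Real.sqrt_pos.2 (by linarith)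
  have hr2 : √(1 - 2 * h) ^ 2 = 1 - 2 * h := Real.sq_sqrt (by linarith)
  have hR : kantRadius p c h = 2 * (‖p.eval c‖ / ‖p.derivative.eval c‖) / (1 + √(1 - 2 * h)) := by
    rw [kantRadius, kantDelta, norm_div]
  have hh : ‖p.eval c‖ * S = h * ‖p.derivative.eval c‖ ^ 2 := by
    rw [heq, kantDelta, kantKappa, norm_div, norm_div, norm_one]
    field_simp
  refine ⟨S, kantRadius p c h, ?_, fun m hm => norm_eval_le_kantLambda p hm, ?_, ?_⟩
  · rw [hR]; positivity
  · have : S * kantRadius p c h = ‖p.derivative.eval c‖ * (1 - √(1 - 2 * h)) := by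
      rw [hR]; field_simp
      linear_combination 2 * hh + ‖p.derivative.eval c‖ ^ 2 * hr2
    rw [this]
    nlinarith
  · rw [hR]; field_simp
    linear_combination (2 * ‖p.eval c‖) * hh + (‖p.eval c‖ * ‖p.derivative.eval c‖ ^ 2) * hr2

/-- The criterion asks for a fixed point of `h ↦ δ κ λ(t*(h))`. This map is nondecreasing on all of
`ℝ` (`√` vanishes on negative arguments), nonnegative and at most `1 / 4`, since `t* ≤ 2 δ ≤ 1`. As
in Knaster–Tarski, the supremum of `{h | h ≤ F h}` is fixed; continuity is not needed. -/
theorem isInBasin_of_le {p : ℂ[X]} {c : ℂ} {S : ℝ} (hne : p.derivative.eval c ≠ 0)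
    (hS : ∀ m ∈ Metric.closedBall c 1, ‖p.derivative.derivative.eval m‖ ≤ S)
    (h1 : 2 * kantDelta p c ≤ 1) (h2 : kantDelta p c * kantKappa p c * S ≤ 1 / 4) :
    IsInBasin p c := by
  have hδ : 0 ≤ kantDelta p c := norm_nonneg _
  have hκ : 0 ≤ kantKappa p c := norm_nonneg _
  have hr0 : ∀ h, 0 ≤ kantRadius p c h := fun h => by unfold kantRadius; positivity
  have hr1 : ∀ h, kantRadius p c h ≤ 1 := fun h => by
    refine le_trans ?_ h1
    unfold kantRadius
    exact div_le_self (by positivity) (by linarith [Real.sqrt_nonneg (1 - 2 * h)])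
  have hrm : Monotone (kantRadius p c) := fun h h' hh => by
    unfold kantRadius
    gcongr
  let F : ℝ → ℝ := fun h => kantDelta p c * kantKappa p c * kantLambda p c (kantRadius p c h)
  have hFm : Monotone F := fun h h' hh =>
    mul_le_mul_of_nonneg_left (kantLambda_mono p c (hr0 h) (hrm hh)) (by positivity)
  have hF0 : ∀ h, 0 ≤ F h := fun h => mul_nonneg (by positivity) (kantLambda_nonneg _ _ _)
  have hF1 : ∀ h, F h ≤ 1 / 4 := fun h => by
    refine le_trans (mul_le_mul_of_nonneg_left ?_ (by positivity)) h2
    refine csSup_le ((Metric.nonempty_closedBall.2 (hr0 h)).image _) ?_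
    rintro _ ⟨m, hm, rfl⟩
    exact hS m (Metric.closedBall_subset_closedBall (hr1 h) hm)
  let A : Set ℝ := {h | h ≤ F h}
  have hAb : BddAbove A := ⟨1 / 4, fun h hh => le_trans hh (hF1 h)⟩
  have hAn : A.Nonempty := ⟨0, hF0 0⟩
  have hle : sSup A ≤ F (sSup A) :=
    csSup_le hAn fun h hh => le_trans hh (hFm (le_csSup hAb hh))
  have hge : F (sSup A) ≤ sSup A := le_csSup hAb (hFm hle)
  exact ⟨hne, sSup A, le_antisymm hle hge, by linarith [hF1 (sSup A)]⟩

/-! ### The moment generating function on the upper half-plane -/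

theorem isOpen_upperHalf : IsOpen upperHalf := isOpen_lt continuous_const Complex.continuous_im

theorem sub_ofReal_ne_zero {z : ℂ} (hz : z ∈ upperHalf) (v : ℝ) : z - v ≠ 0 := fun h => by
  have := congrArg Complex.im h
  simp only [Complex.sub_im, Complex.ofReal_im, sub_zero, Complex.zero_im] at this
  exact (ne_of_gt hz) this

theorem im_le_norm_sub_ofReal (z : ℂ) (v : ℝ) : z.im ≤ ‖z - v‖ := by
  simpa using (le_abs_self _).trans (Complex.abs_im_le_norm (z - v))

theorem ofReal_div_sub_eq {z : ℂ} (hz : z ∈ upperHalf) (v : ℝ) :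
    (v : ℂ) / (z - v) = z * (z - v)⁻¹ - 1 := by
  have := sub_ofReal_ne_zero hz v
  field_simp
  ring

theorem norm_inv_sub_ofReal_le {z : ℂ} (hz : z ∈ upperHalf) (v : ℝ) :
    ‖(z - v)⁻¹‖ ≤ 1 / z.im := by
  rw [norm_inv, ← one_div]
  exact one_div_le_one_div_of_le hz (im_le_norm_sub_ofReal z v)

theorem norm_ofReal_div_sub_le {z : ℂ} (hz : z ∈ upperHalf) (v : ℝ) :
    ‖(v : ℂ) / (z - v)‖ ≤ ‖z‖ / z.im + 1 := by
  rw [ofReal_div_sub_eq hz]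
  refine (norm_sub_le _ _).trans ?_
  rw [norm_mul, norm_one, div_eq_mul_one_div]
  gcongr
  exact norm_inv_sub_ofReal_le hz v

section Transform

variable (ν : Measure ℝ) [IsProbabilityMeasure ν]

theorem integrable_inv_sub_ofReal {z : ℂ} (hz : z ∈ upperHalf) :
    Integrable (fun v : ℝ => (z - (v : ℂ))⁻¹) ν :=
  Integrable.of_bound (by fun_prop) (1 / z.im)
    (Eventually.of_forall fun v => norm_inv_sub_ofReal_le hz v)

theorem integrable_ofReal_div_sub {z : ℂ} (hz : z ∈ upperHalf) :
    Integrable (fun v : ℝ => (v : ℂ) / (z - v)) ν :=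
  Integrable.of_bound (Measurable.aestronglyMeasurable (by fun_prop)) (‖z‖ / z.im + 1)
    (Eventually.of_forall fun v => norm_ofReal_div_sub_le hz v)

theorem momentGen_eq_integral {z : ℂ} (hz : z ∈ upperHalf) :
    momentGen ν z = ∫ v : ℝ, (v : ℂ) / (z - v) ∂ν := by
  simp only [ofReal_div_sub_eq hz]
  rw [integral_sub ((integrable_inv_sub_ofReal ν hz).const_mul z) (integrable_const _),
    integral_const_mul]
  simp [momentGen, cauchyTransform]

theorem norm_momentGen_le {z : ℂ} (hz : z ∈ upperHalf) :
    ‖momentGen ν z‖ ≤ ‖z‖ / z.im + 1 := by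
  rw [momentGen_eq_integral ν hz]
  simpa using norm_integral_le_of_norm_le_const (μ := ν)
    (Eventually.of_forall fun v => norm_ofReal_div_sub_le hz v)

theorem hasDerivAt_momentGen {z : ℂ} (hz : z ∈ upperHalf) :
    HasDerivAt (momentGen ν) (∫ v : ℝ, -((v : ℂ) / (z - v) ^ 2) ∂ν) z := by
  have hz' : 0 < z.im := hz
  have him : ∀ w ∈ Metric.ball z (z.im / 2), z.im / 2 < w.im := fun w hw => by
    have h1 := (Complex.abs_im_le_norm (w - z)).trans_lt (by simpa [dist_eq_norm] using hw)
    rw [Complex.sub_im] at h1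
    linarith [(abs_lt.1 h1).1]
  have hup : ∀ w ∈ Metric.ball z (z.im / 2), w ∈ upperHalf := fun w hw =>
    (half_pos hz').trans (him w hw)
  have key := hasDerivAt_integral_of_dominated_loc_of_deriv_le (μ := ν) (𝕜 := ℂ)
    (F := fun w v => (v : ℂ) / (w - v)) (F' := fun w v => -((v : ℂ) / (w - v) ^ 2))
    (x₀ := z) (s := Metric.ball z (z.im / 2))
    (bound := fun _ => ((‖z‖ + z.im / 2) / (z.im / 2) + 1) * (1 / (z.im / 2)))
    (Metric.ball_mem_nhds z (half_pos hz'))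
    (Eventually.of_forall fun w => Measurable.aestronglyMeasurable (by fun_prop))
    (integrable_ofReal_div_sub ν hz) (Measurable.aestronglyMeasurable (by fun_prop))
    (Eventually.of_forall fun v w hw => by
      have h1 := norm_ofReal_div_sub_le (hup w hw) v
      have h2 := norm_inv_sub_ofReal_le (hup w hw) v
      have h3 := (him w hw).le
      have h4 : ‖w‖ ≤ ‖z‖ + z.im / 2 := by
        have := norm_le_norm_add_norm_sub' w z
        have h5 : ‖w - z‖ < z.im / 2 := by simpa [dist_eq_norm] using hw
        linarith
      have h6 : (v : ℂ) / (w - v) ^ 2 = (v : ℂ) / (w - v) * (w - v)⁻¹ := by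
        rw [pow_two, div_mul_eq_div_div, div_eq_mul_inv ((v : ℂ) / (w - v))]
      rw [norm_neg, h6, norm_mul]
      refine mul_le_mul (h1.trans ?_) (h2.trans ?_) (norm_nonneg _) (by positivity)
      · gcongr
      · gcongr)
    (integrable_const _)
    (Eventually.of_forall fun v w hw => by
      have h := ((hasDerivAt_id w).sub_const (v : ℂ)).inv (sub_ofReal_ne_zero (hup w hw) v)
      refine ((h.const_mul (v : ℂ)).congr_deriv ?_).congr_of_eventuallyEq ?_
      · simp; ring
      · exact Eventually.of_forall fun w => by simp [div_eq_mul_inv])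
  refine key.2.congr_of_eventuallyEq ?_
  filter_upwards [isOpen_upperHalf.mem_nhds hz] with w hw
  exact momentGen_eq_integral ν hw

theorem differentiableOn_momentGen : DifferentiableOn ℂ (momentGen ν) upperHalf :=
  fun _ hz => (hasDerivAt_momentGen ν hz).differentiableAt.differentiableWithinAt

/-- The Schwarz-Pick type bound `|M'(z)| ≤ |M(z)| / Im z`. -/
theorem im_mul_norm_deriv_momentGen_le (hν : ν (Set.Iio 0) = 0) {z : ℂ} (hz : z ∈ upperHalf) :
    z.im * ‖∫ v : ℝ, -((v : ℂ) / (z - v) ^ 2) ∂ν‖ ≤ ‖momentGen ν z‖ := by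
  have hz' : 0 < z.im := hz
  have hpos : ∀ᵐ v ∂ν, 0 ≤ v := by
    rw [ae_iff]; simpa [Set.Iio] using hν
  have himv : ∀ v : ℝ, ((v : ℂ) / (z - v)).im = -(z.im * (v / ‖z - v‖ ^ 2)) := fun v => by
    rw [Complex.div_im, Complex.normSq_eq_norm_sq]
    simp
    ring
  -- The integral that gives `-Im M / Im z` also bounds `|M'|`, because `v ≥ 0` almost everywhere.
  have him : (momentGen ν z).im = -(z.im * ∫ v : ℝ, v / ‖z - v‖ ^ 2 ∂ν) := by
    rw [momentGen_eq_integral ν hz, ← integral_const_mul, ← integral_neg]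
    have := integral_im (𝕜 := ℂ) (integrable_ofReal_div_sub ν hz)
    simp only [RCLike.im_to_complex] at this
    rw [← this]
    exact integral_congr_ae (Eventually.of_forall himv)
  have h1 : ‖∫ v : ℝ, -((v : ℂ) / (z - v) ^ 2) ∂ν‖ ≤ ∫ v : ℝ, v / ‖z - v‖ ^ 2 ∂ν := by
    refine (norm_integral_le_integral_norm _).trans (le_of_eq (integral_congr_ae ?_))
    filter_upwards [hpos] with v hv
    rw [norm_neg, norm_div, norm_pow, Complex.norm_real, Real.norm_of_nonneg hv]
  calc _ ≤ z.im * ∫ v : ℝ, v / ‖z - v‖ ^ 2 ∂ν := by gcongr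
    _ = -(momentGen ν z).im := by rw [him, neg_neg]
    _ ≤ |(momentGen ν z).im| := neg_le_abs _
    _ ≤ _ := Complex.abs_im_le_norm _

/-- Dominated convergence without any moment assumption: on a vertical ray `|w| / Im w` is bounded,
hence so is `v / (w - v)`, uniformly in `v`. -/
theorem tendsto_momentGen_vertical {z : ℂ} (hz : z ∈ upperHalf) :
    Tendsto (fun T : ℝ => momentGen ν (z + Complex.I * T)) atTop (𝓝 0) := by
  have hz' : 0 < z.im := hz
  have hw : ∀ T : ℝ, 0 ≤ T → z + Complex.I * T ∈ upperHalf := fun T hT => by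
    simp only [upperHalf, Set.mem_ofPred_eq, Complex.add_im, Complex.mul_im, Complex.I_re,
      Complex.I_im, Complex.ofReal_re, Complex.ofReal_im]
    linarith
  have hnorm : Tendsto (fun T : ℝ => ‖z + Complex.I * T‖) atTop atTop := by
    refine tendsto_atTop_mono (fun T => ?_) tendsto_id
    have := (le_abs_self _).trans (Complex.abs_im_le_norm (z + Complex.I * T))
    simp at this
    simp only [id]
    linarith
  have key := tendsto_integral_filter_of_dominated_convergence (μ := ν) (l := atTop)
    (F := fun (T : ℝ) (v : ℝ) => (v : ℂ) / (z + Complex.I * T - v)) (f := fun _ => 0)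
    (bound := fun _ => ‖z‖ / z.im + 2)
    (Eventually.of_forall fun T => Measurable.aestronglyMeasurable (by fun_prop))
    (by
      filter_upwards [eventually_ge_atTop 0] with T hT
      refine Eventually.of_forall fun v => (norm_ofReal_div_sub_le (hw T hT) v).trans ?_
      have him : (z + Complex.I * T).im = z.im + T := by simp
      have h1 : ‖z + Complex.I * T‖ ≤ ‖z‖ + T := by
        refine (norm_add_le _ _).trans ?_
        simp [abs_of_nonneg hT]
      rw [him]
      have h2 : ‖z + Complex.I * T‖ / (z.im + T) ≤ ‖z‖ / z.im + 1 := by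
        calc _ ≤ (‖z‖ + T) / (z.im + T) := by gcongr
          _ = ‖z‖ / (z.im + T) + T / (z.im + T) := add_div _ _ _
          _ ≤ _ := by
            gcongr
            · linarith
            · rw [div_le_one (by linarith)]; linarith
      linarith)
    (integrable_const _)
    (Eventually.of_forall fun v => by
      have h : Tendsto (fun T : ℝ => ‖z + Complex.I * T - v‖) atTop atTop := by
        refine tendsto_atTop_mono (fun T => norm_sub_norm_le _ _) ?_
        exact tendsto_atTop_add_const_right _ _ hnorm
      rw [tendsto_zero_iff_norm_tendsto_zero]
      simp only [norm_div]
      exact h.const_div_atTop _)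
  rw [integral_zero] at key
  refine key.congr' ?_
  filter_upwards [eventually_ge_atTop 0] with T hT
  exact (momentGen_eq_integral ν (hw T hT)).symm

end Transform

/-! ### The master equation -/

/-- A holomorphic function on the upper half-plane that vanishes on the values in this half-plane
of `P m / m`, for `m` near `0`, vanishes identically. -/
theorem eqOn_zero_of_comp_eq_zero {P : ℂ[X]} {b : ℝ} (hb : 0 < b) (hP : P.eval 0 = b)
    {h : ℂ → ℂ} (hh : DifferentiableOn ℂ h upperHalf)
    (hz : ∀ᶠ m in 𝓝[≠] (0 : ℂ), P.eval m / m ∈ upperHalf → h (P.eval m / m) = 0) :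
    Set.EqOn h 0 upperHalf := by
  obtain ⟨ε, hε, hball⟩ := Metric.mem_nhdsWithin_iff.1 hz
  have hcont : Tendsto (fun t : ℝ => (P.eval (-(Complex.I * t))).re) (𝓝[>] 0) (𝓝 b) := by
    have h1 : Continuous fun t : ℝ => (P.eval (-(Complex.I * t))).re :=
      Complex.continuous_re.comp (P.continuous.comp (by fun_prop))
    have h2 := h1.tendsto 0
    simp only [Complex.ofReal_zero, mul_zero, neg_zero, hP, Complex.ofReal_re] at h2
    exact h2.mono_left nhdsWithin_le_nhds
  obtain ⟨t, ht1, ht2, ht0⟩ := ((hcont.eventually_const_lt hb).and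
    ((eventually_lt_nhds hε).filter_mono nhdsWithin_le_nhds |>.and
      self_mem_nhdsWithin)).exists
  have ht0' : 0 < t := ht0
  -- For `m₀ = -i t`, the imaginary part of `P(m₀) / m₀` is `Re P(m₀) / t`, positive for small `t`
  -- because `P(0) > 0`.
  set m₀ : ℂ := -(Complex.I * t) with hm₀
  have hm₀ne : m₀ ≠ 0 := by simp [hm₀, ht0'.ne']
  have hm₀ball : m₀ ∈ Metric.ball (0 : ℂ) ε := by simp [hm₀, abs_of_pos ht0', ht2]
  have hup : P.eval m₀ / m₀ ∈ upperHalf := by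
    have : P.eval m₀ / m₀ = Complex.I * P.eval m₀ / t := by
      have : (t : ℂ) ≠ 0 := by exact_mod_cast ht0'.ne'
      rw [div_eq_div_iff hm₀ne this, hm₀]
      linear_combination (P.eval (-(Complex.I * t)) * t) * Complex.I_mul_I
    rw [this, upperHalf, Set.mem_ofPred_eq, Complex.div_ofReal_im]
    simp only [Complex.mul_im, Complex.I_re, Complex.I_im]
    have : 0 < (P.eval m₀).re := ht1
    simp only [zero_mul, one_mul, zero_add]
    positivity
  have hca : ContinuousAt (fun m => P.eval m / m) m₀ :=
    P.continuous.continuousAt.div continuousAt_id hm₀ne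
  have hev : ∀ᶠ m in 𝓝 m₀, h (P.eval m / m) = 0 := by
    filter_upwards [Metric.isOpen_ball.mem_nhds hm₀ball, isOpen_ne.mem_nhds hm₀ne,
      hca.preimage_mem_nhds (isOpen_upperHalf.mem_nhds hup)] with m h1 h2 h3
    exact hball ⟨h1, h2⟩ h3
  -- The fibre of `P(m) / m` is finite, so the zeros of `h` found above really accumulate at `P(m₀)
  -- / m₀`.
  have hne : ∀ᶠ m in 𝓝[≠] m₀, P.eval m / m ≠ P.eval m₀ / m₀ := by
    set p : ℂ[X] := P - C (P.eval m₀ / m₀) * X with hp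
    have hp0 : p ≠ 0 := fun h0 => by
      have : p.eval 0 = b := by simp [hp, hP]
      rw [h0, eval_zero] at this
      exact hb.ne (by exact_mod_cast this)
    have hfin : ({m | p.IsRoot m} \ {m₀}).Finite := (finite_setOfPred_isRoot hp0).subset Set.sdiff_subset
    have hmem : ({m | p.IsRoot m} \ {m₀})ᶜ ∈ 𝓝 m₀ := hfin.isClosed.isOpen_compl.mem_nhds (by simp)
    filter_upwards [nhdsWithin_le_nhds hmem, self_mem_nhdsWithin,
      nhdsWithin_le_nhds (isOpen_ne.mem_nhds hm₀ne)] with m h1 h2 h3 h4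
    refine h1 ⟨?_, h2⟩
    change p.eval m = 0
    have h3' : m ≠ 0 := h3
    simp only [hp, eval_sub, eval_mul, eval_C, eval_X]
    rw [← h4, div_mul_cancel₀ _ h3', sub_self]
  have htend : Tendsto (fun m => P.eval m / m) (𝓝[≠] m₀) (𝓝[≠] (P.eval m₀ / m₀)) :=
    tendsto_nhdsWithin_iff.2 ⟨hca.tendsto.mono_left nhdsWithin_le_nhds, hne⟩
  exact (hh.analyticOnNhd isOpen_upperHalf).eqOn_zero_of_preconnected_of_frequently_eq_zero
    (convex_halfSpace_im_gt 0).isPreconnected hup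
    (htend.frequently (hev.filter_mono nhdsWithin_le_nhds).frequently)

/-- The properties of a branch `M` of the inverse of `P(m) / m` on the upper half-plane that are
used to follow it by Newton's method. -/
structure IsMasterBranch (P : ℂ[X]) (M : ℂ → ℂ) : Prop where
  eval_zero : ∃ b : ℝ, 0 < b ∧ P.eval 0 = b
  derivative_eval_zero : ∃ d : ℝ, P.derivative.eval 0 = d
  continuousOn : ContinuousOn M upperHalf
  eval_eq : ∀ z ∈ upperHalf, P.eval (M z) = z * M z
  im_le_norm : ∀ z ∈ upperHalf, z.im ≤ ‖P.derivative.eval (M z) - z‖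
  norm_le : ∀ z ∈ upperHalf, ‖M z‖ ≤ ‖z‖ / z.im + 1
  tendsto_vertical : ∀ z ∈ upperHalf,
    Tendsto (fun T : ℝ => M (z + Complex.I * T)) atTop (𝓝 0)

theorem isMasterBranch_momentGen {P : ℂ[X]} {b d : ℝ} (hb : 0 < b) (hP : P.eval 0 = b)
    (hP' : P.derivative.eval 0 = d) (ν : Measure ℝ) [IsProbabilityMeasure ν]
    (hν : ν (Set.Iio 0) = 0) (hf : IsMomentGenInverse ν fun m => P.eval m / m) :
    IsMasterBranch P (momentGen ν) := by
  have hroot : ∀ z ∈ upperHalf, P.eval (momentGen ν z) = z * momentGen ν z := by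
    have h1 : DifferentiableOn ℂ
        (fun z => P.eval (momentGen ν z) - z * momentGen ν z) upperHalf :=
      (P.differentiable.comp_differentiableOn (differentiableOn_momentGen ν)).sub
        (differentiableOn_id.mul (differentiableOn_momentGen ν))
    have h2 := eqOn_zero_of_comp_eq_zero hb hP h1 (by
      filter_upwards [hf, self_mem_nhdsWithin] with m hm hm0 _
      have hm0' : m ≠ 0 := hm0
      rw [hm, div_mul_cancel₀ _ hm0', sub_self])
    exact fun z hz => sub_eq_zero.1 (h2 hz)
  refine ⟨⟨b, hb, hP⟩, ⟨d, hP'⟩, (differentiableOn_momentGen ν).continuousOn, hroot,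
    fun z hz => ?_, fun z hz => norm_momentGen_le ν hz,
    fun z hz => tendsto_momentGen_vertical ν hz⟩
  have hM := hasDerivAt_momentGen ν hz
  have hle := im_mul_norm_deriv_momentGen_le ν hν hz
  set M' := ∫ v : ℝ, -((v : ℂ) / (z - v) ^ 2) ∂ν
  have hne : momentGen ν z ≠ 0 := fun h0 => by
    have := hroot z hz
    rw [h0, hP, mul_zero] at this
    exact hb.ne' (by exact_mod_cast this)
  have h3 : HasDerivAt (fun z => P.eval (momentGen ν z) - z * momentGen ν z)
      (P.derivative.eval (momentGen ν z) * M' - (1 * momentGen ν z + z * M')) z :=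
    ((P.hasDerivAt _).comp z hM).sub ((hasDerivAt_id z).mul hM)
  have h4 : HasDerivAt (fun z => P.eval (momentGen ν z) - z * momentGen ν z) 0 z := by
    refine (hasDerivAt_const z (0 : ℂ)).congr_of_eventuallyEq ?_
    filter_upwards [isOpen_upperHalf.mem_nhds hz] with w hw
    rw [hroot w hw, sub_self]
  have h5 : (P.derivative.eval (momentGen ν z) - z) * M' = momentGen ν z := by
    linear_combination h3.unique h4
  have h6 : M' ≠ 0 := fun h0 => hne (by rw [← h5, h0, mul_zero])
  rw [← h5, norm_mul] at hle
  exact le_of_mul_le_mul_right hle (norm_pos_iff.2 h6)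

theorem masterNum_eval_zero {L : ℕ} {σ c lam : Fin L → ℝ} (hσ : ∀ l, 0 < σ l)
    (hc : ∀ l, 0 < c l) : ∃ b : ℝ, 0 < b ∧ (masterNum σ c lam).eval 0 = b := by
  refine ⟨∏ l, σ l ^ 2 * c l, Finset.prod_pos fun l _ => mul_pos (pow_pos (hσ l) 2) (hc l), ?_⟩
  simp [masterNum, eval_prod]

/-- Real coefficients make `P'(0)` real, so `|P'(0) - w|` increases with the height of `w`. -/
theorem masterNum_derivative_eval_zero {L : ℕ} (σ c lam : Fin L → ℝ) :
    ∃ d : ℝ, (masterNum σ c lam).derivative.eval 0 = d := by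
  have h : masterNum σ c lam = ((X + 1) * ∏ l, C (σ l ^ 2) *
      (C (c l) + C (widthRatio lam l) * X) : ℝ[X]).map Complex.ofRealHom := by
    simp [masterNum, Polynomial.map_prod]
  exact ⟨_, by rw [h, derivative_map, ← coeff_zero_eq_eval_zero, coeff_map]; rfl⟩

/-! ### Basins of the polynomials `P / z - X` -/

theorem phiPoly_eval (P : ℂ[X]) {w : ℂ} (hw : w ≠ 0) (m : ℂ) :
    (phiPoly P X w).eval m = (P.eval m - w * m) / w := by
  simp [phiPoly]; field_simp

theorem phiPoly_derivative_eval (P : ℂ[X]) {w : ℂ} (hw : w ≠ 0) (m : ℂ) :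
    (phiPoly P X w).derivative.eval m = (P.derivative.eval m - w) / w := by
  simp [phiPoly]; field_simp

theorem phiPoly_derivative_derivative_eval (P : ℂ[X]) (w m : ℂ) :
    (phiPoly P X w).derivative.derivative.eval m = P.derivative.derivative.eval m / w := by
  simp [phiPoly, div_eq_inv_mul]

theorem phiPoly_eval_eq_zero_iff (P : ℂ[X]) {w : ℂ} (hw : w ≠ 0) (m : ℂ) :
    (phiPoly P X w).eval m = 0 ↔ P.eval m = w * m := by
  rw [phiPoly_eval P hw, div_eq_zero_iff, or_iff_left hw, sub_eq_zero]

/-- Multiplying by `w` replaces `P / w - X` by `P - w X`, whose second derivative does not depend on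
`w`. By uniqueness in the disc, any root located there is the Newton limit. -/
theorem exists_radius_of_isInBasin_phiPoly {P : ℂ[X]} {w c : ℂ} (hw : w ≠ 0)
    (h : IsInBasin (phiPoly P X w) c) :
    ∃ S R : ℝ, 0 ≤ R ∧ (∀ m ∈ Metric.closedBall c R, ‖P.derivative.derivative.eval m‖ ≤ S) ∧
      S * R < ‖P.derivative.eval c - w‖ ∧
      S / 2 * R ^ 2 - ‖P.derivative.eval c - w‖ * R + ‖P.eval c - w * c‖ = 0 ∧
      ∀ m ∈ Metric.closedBall c R, P.eval m = w * m → NewtonReturns (phiPoly P X w) c m := by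
  obtain ⟨S, R, hR, hS, hSR, hq⟩ := h.exists_radius
  obtain ⟨m₁, hm₁, hroot, hnew⟩ := exists_newtonReturns _ hR hS hSR hq
  have hw' : 0 < ‖w‖ := norm_pos_iff.2 hw
  refine ⟨S * ‖w‖, R, hR, fun m hm => ?_, ?_, ?_, fun m hm hPm => ?_⟩
  · have := hS m hm
    rwa [phiPoly_derivative_derivative_eval, norm_div, div_le_iff₀ hw'] at this
  · rw [phiPoly_derivative_eval P hw, norm_div, lt_div_iff₀ hw'] at hSR
    linarith
  · rw [phiPoly_derivative_eval P hw, phiPoly_eval P hw, norm_div, norm_div] at hq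
    field_simp at hq
    linear_combination hq / 2
  · rwa [root_unique_of_mul_lt _ hS hSR hm hm₁ ((phiPoly_eval_eq_zero_iff P hw m).2 hPm) hroot]

theorem isInBasin_phiPoly_of_le {P : ℂ[X]} {w c : ℂ} {S η : ℝ} (hw : w ≠ 0) (hη : 0 < η)
    (hηle : η ≤ ‖P.derivative.eval c - w‖)
    (hS : ∀ m ∈ Metric.closedBall c 1, ‖P.derivative.derivative.eval m‖ ≤ S)
    (h1 : 2 * ‖P.eval c - w * c‖ ≤ η) (h2 : 4 * ‖P.eval c - w * c‖ * S ≤ η ^ 2) :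
    IsInBasin (phiPoly P X w) c := by
  have hw' : 0 < ‖w‖ := norm_pos_iff.2 hw
  have ha : 0 < ‖P.derivative.eval c - w‖ := hη.trans_le hηle
  have hδ : kantDelta (phiPoly P X w) c = ‖P.eval c - w * c‖ / ‖P.derivative.eval c - w‖ := by
    rw [kantDelta, phiPoly_eval P hw, phiPoly_derivative_eval P hw, div_div_div_cancel_right₀ hw,
      norm_div]
  have hκ : kantKappa (phiPoly P X w) c = ‖w‖ / ‖P.derivative.eval c - w‖ := by
    rw [kantKappa, phiPoly_derivative_eval P hw, one_div_div, norm_div]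
  refine isInBasin_of_le (S := S / ‖w‖) ?_ (fun m hm => ?_) ?_ ?_
  · rw [phiPoly_derivative_eval P hw]
    exact div_ne_zero (norm_pos_iff.1 ha) hw
  · rw [phiPoly_derivative_derivative_eval, norm_div]
    exact div_le_div_of_nonneg_right (hS m hm) hw'.le
  · rw [hδ, ← mul_div_assoc, div_le_one ha]
    linarith
  · have : ‖P.eval c - w * c‖ / ‖P.derivative.eval c - w‖ * (‖w‖ / ‖P.derivative.eval c - w‖) *
        (S / ‖w‖) = ‖P.eval c - w * c‖ * S / ‖P.derivative.eval c - w‖ ^ 2 := by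
      field_simp
    rw [hδ, hκ, this, div_le_iff₀ (by positivity)]
    have := pow_le_pow_left₀ hη.le hηle 2
    linarith

/-! ### Following the branch along a path -/

/-- Taylor's formula at `c`. Used in contrapositive form, as a barrier on the circle of radius `R`.
-/
theorem norm_derivative_mul_le_of_root {P : ℂ[X]} {w c m : ℂ} {R S : ℝ} (hR : 0 ≤ R)
    (hS : ∀ m ∈ Metric.closedBall c R, ‖P.derivative.derivative.eval m‖ ≤ S)
    (hm : ‖m - c‖ = R) (hroot : P.eval m = w * m) :
    ‖P.derivative.eval c - w‖ * R ≤ ‖P.eval c - w * c‖ + S / 2 * R ^ 2 := by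
  have h1 := norm_eval_sub_linear_le P hS (Metric.mem_closedBall_self hR)
    (y := m) (by rw [Metric.mem_closedBall, dist_eq_norm, hm])
  have h2 : (P.derivative.eval c - w) * (m - c) = -(P.eval c - w * c) -
      (P.eval m - P.eval c - P.derivative.eval c * (m - c)) := by
    rw [hroot]; ring
  rw [hm] at h1
  rw [← hm, ← norm_mul, h2, hm]
  refine (norm_sub_le _ _).trans ?_
  rw [norm_neg]
  gcongr

/-- A continuous branch of roots of `P - w X` along a path of values of `w` does not leave a disc
if no root lies on the boundary circle before the end of the path. -/
theorem IsMasterBranch.norm_sub_le_of_path {P : ℂ[X]} {M : ℂ → ℂ} (hM : IsMasterBranch P M)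
    {c : ℂ} {R S : ℝ} (hR : 0 ≤ R)
    (hS : ∀ m ∈ Metric.closedBall c R, ‖P.derivative.derivative.eval m‖ ≤ S)
    {w : ℝ → ℂ} (hw : Continuous w) (hup : ∀ s ∈ Set.Icc (0 : ℝ) 1, w s ∈ upperHalf)
    (hlt : ∀ s ∈ Set.Ico (0 : ℝ) 1,
      ‖P.eval c - w s * c‖ + S / 2 * R ^ 2 < ‖P.derivative.eval c - w s‖ * R)
    (h0 : ‖M (w 0) - c‖ ≤ R) : ‖M (w 1) - c‖ ≤ R := by
  by_contra! h1
  have hcont : ContinuousOn (fun s => ‖M (w s) - c‖) (Set.Icc 0 1) :=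
    ((hM.continuousOn.comp hw.continuousOn hup).sub continuousOn_const).norm
  obtain ⟨s, hs, hsR⟩ := intermediate_value_Ico zero_le_one hcont ⟨h0, h1⟩
  exact absurd (norm_derivative_mul_le_of_root hR hS hsR
    (hM.eval_eq _ (hup s ⟨hs.1, hs.2.le⟩))) (not_le.2 (hlt s hs))

/-- `D + i s τ` is `(1 + s) / 2 * (D + i τ) + (1 - s) / 2 * (D - i τ)`, and these two vectors have
inner product `|D|² - τ² ≥ 0`. -/
theorem half_one_add_mul_norm_le {D : ℂ} {τ s : ℝ} (hτ : 0 ≤ τ) (hD : τ ≤ ‖D‖)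
    (hs0 : 0 ≤ s) (hs1 : s ≤ 1) :
    (1 + s) / 2 * ‖D + Complex.I * τ‖ ≤ ‖D + Complex.I * (s * τ : ℝ)‖ := by
  have hD2 := pow_le_pow_left₀ hτ hD 2
  refine le_of_sq_le_sq ?_ (norm_nonneg _)
  rw [mul_pow]
  simp only [← Complex.normSq_eq_norm_sq, Complex.normSq_apply, Complex.add_re, Complex.add_im,
    Complex.mul_re, Complex.mul_im, Complex.I_re, Complex.I_im, Complex.ofReal_re,
    Complex.ofReal_im] at hD2 ⊢
  have h1 : 0 ≤ (1 - s) ^ 2 * (D.im - τ) ^ 2 := by positivity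
  have h2 := mul_nonneg (sub_nonneg.2 hs1) (sub_nonneg.2 hD2)
  have h3 := mul_nonneg hs0 h2
  nlinarith [mul_nonneg (mul_nonneg (sub_nonneg.2 hs1) (sub_nonneg.2 hs1)) (sq_nonneg D.re)]

theorem ne_zero_of_mem_upperHalf {z : ℂ} (hz : z ∈ upperHalf) : z ≠ 0 := fun h => by
  rw [h] at hz
  exact lt_irrefl (0 : ℝ) hz

namespace IsMasterBranch

variable {P : ℂ[X]} {M : ℂ → ℂ}

theorem ne_zero (hM : IsMasterBranch P M) {z : ℂ} (hz : z ∈ upperHalf) : M z ≠ 0 := fun h0 => by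
  obtain ⟨b, hb, hP⟩ := hM.eval_zero
  have := hM.eval_eq z hz
  rw [h0, hP, mul_zero] at this
  exact hb.ne' (by exact_mod_cast this)

theorem newtonReturns_zero (hM : IsMasterBranch P M) {z : ℂ} (hz : z ∈ upperHalf)
    (h : IsInBasin (phiPoly P X z) 0) : NewtonReturns (phiPoly P X z) 0 (M z) := by
  have hz' : 0 < z.im := hz
  obtain ⟨b, hb, hP⟩ := hM.eval_zero
  obtain ⟨d, hd⟩ := hM.derivative_eval_zero
  obtain ⟨S, R, hR, hS, hSR, hq, hnew⟩ :=
    exists_radius_of_isInBasin_phiPoly (ne_zero_of_mem_upperHalf hz) h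
  rw [hd, hP, mul_zero, sub_zero, Complex.norm_real, Real.norm_of_nonneg hb.le] at hq
  have hR' : 0 < R := by
    refine lt_of_le_of_ne hR fun h0 => ?_
    rw [← h0] at hq
    linarith
  obtain ⟨T, hT, hT0⟩ := (((hM.tendsto_vertical z hz).norm.eventually_le_const
    (by simpa using hR')).and (eventually_gt_atTop 0)).exists
  have key := hM.norm_sub_le_of_path hR hS
    (w := fun s : ℝ => z + Complex.I * (T * (1 - s) : ℝ)) (by fun_prop)
    (fun s hs => by
      have : 0 ≤ T * (1 - s) := mul_nonneg hT0.le (by linarith [hs.2])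
      simp [upperHalf] at this ⊢
      linarith)
    (fun s hs => by
      have hpos : 0 < T * (1 - s) := mul_pos hT0 (by linarith [hs.2])
      rw [hd, hP, mul_zero, sub_zero, Complex.norm_real, Real.norm_of_nonneg hb.le]
      -- At guess `0` the residual `b` is constant along the path, while the derivative is strictly
      -- larger above `z`.
      have hlt : ‖(d : ℂ) - z‖ < ‖(d : ℂ) - (z + Complex.I * (T * (1 - s) : ℝ))‖ := by
        refine lt_of_pow_lt_pow_left₀ 2 (norm_nonneg _) ?_
        simp only [← Complex.normSq_eq_norm_sq, Complex.normSq_apply, Complex.add_re,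
          Complex.add_im, Complex.sub_re, Complex.sub_im,
          Complex.mul_re, Complex.mul_im, Complex.I_re, Complex.I_im, Complex.ofReal_re,
          Complex.ofReal_im]
        nlinarith [mul_pos hpos hz', mul_pos hpos hpos]
      have := mul_lt_mul_of_pos_right hlt hR'
      linarith) (by simpa using hT)
  simp only [sub_self, mul_zero, Complex.ofReal_zero, add_zero] at key
  exact hnew _ (by rw [Metric.mem_closedBall, dist_eq_norm]; exact key) (hM.eval_eq z hz)

theorem newtonReturns_vertical (hM : IsMasterBranch P M) {z : ℂ} (hz : z ∈ upperHalf) {τ : ℝ}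
    (hτ : 0 < τ) (hτz : τ < z.im) (h : IsInBasin (phiPoly P X (z + -(Complex.I * τ))) (M z)) :
    NewtonReturns (phiPoly P X (z + -(Complex.I * τ))) (M z) (M (z + -(Complex.I * τ))) := by
  have hup : ∀ s : ℝ, s ≤ τ → z + -(Complex.I * s) ∈ upperHalf := fun s hs => by
    simp [upperHalf]
    linarith
  obtain ⟨S, R, hR, hS, hSR, hq, hnew⟩ :=
    exists_radius_of_isInBasin_phiPoly (ne_zero_of_mem_upperHalf (hup τ le_rfl)) h
  have hD : ∀ s : ℝ, P.derivative.eval (M z) - (z + -(Complex.I * s)) =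
      P.derivative.eval (M z) - z + Complex.I * s := fun s => by ring
  have hG : ∀ s : ℝ, 0 ≤ s → ‖P.eval (M z) - (z + -(Complex.I * s)) * M z‖ = s * ‖M z‖ :=
    fun s hs => by
      have : P.eval (M z) - (z + -(Complex.I * s)) * M z = Complex.I * s * M z := by
        rw [hM.eval_eq z hz]; ring
      rw [this, norm_mul, norm_mul, Complex.norm_I, Complex.norm_real, Real.norm_of_nonneg hs,
        one_mul]
  rw [hG τ hτ.le] at hq
  rw [hD] at hq hSR
  have hb : 0 < τ * ‖M z‖ := mul_pos hτ (norm_pos_iff.2 (hM.ne_zero hz))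
  have hR' : 0 < R := by
    refine lt_of_le_of_ne hR fun h0 => ?_
    rw [← h0] at hq
    linarith
  have key := hM.norm_sub_le_of_path hR hS
    (w := fun s : ℝ => z + -(Complex.I * (s * τ : ℝ))) (by fun_prop)
    (fun s hs => hup _ (mul_le_of_le_one_left hτ.le hs.2))
    (fun s hs => by
      rw [hD, hG _ (mul_nonneg hs.1 hτ.le)]
      have h1 := half_one_add_mul_norm_le hτ.le
        (hτz.le.trans (hM.im_le_norm z hz)) hs.1 hs.2.le
      have h2 := mul_le_mul_of_nonneg_right h1 hR
      have h3 := mul_pos (mul_pos (sub_pos.2 hs.2) hR') (sub_pos.2 hSR)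
      refine lt_of_lt_of_le ?_ h2
      -- With `a = ‖D + i τ‖`, the gap between the two sides is `(1 - s) / 2 * R * (a - S R)`.
      linear_combination h3 / 2 + s * hq)
    (by simpa using hR)
  simp only [one_mul] at key
  exact hnew _ (by rw [Metric.mem_closedBall, dist_eq_norm]; exact key)
    (hM.eval_eq _ (hup τ le_rfl))

/-- Along a bounded part of the upper half-plane that stays away from the real axis, vertical steps
below a uniform length satisfy the Kantorovich criterion. -/
theorem exists_step (hM : IsMasterBranch P M) {y K : ℝ} (hy : 0 < y) :
    ∃ ε > 0, ∀ z : ℂ, ‖z‖ ≤ K → ∀ τ : ℝ, 0 < τ → τ ≤ ε → y + τ ≤ z.im →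
      IsInBasin (phiPoly P X (z + -(Complex.I * τ))) (M z) := by
  rcases lt_or_ge K 0 with hK | hK
  · exact ⟨1, one_pos, fun z hz => absurd ((norm_nonneg z).trans hz) (not_le.2 hK)⟩
  set B := K / y + 1 with hB
  have hB1 : 1 ≤ B := by rw [hB]; linarith [div_nonneg hK hy.le]
  obtain ⟨S, hS⟩ := bddAbove_norm_eval_closedBall P.derivative.derivative 0 (B + 1)
  have hS' : ∀ m : ℂ, ‖m‖ ≤ B + 1 → ‖P.derivative.derivative.eval m‖ ≤ S := fun m hm =>
    hS ⟨m, by simpa using hm, rfl⟩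
  have hS0 : 0 ≤ S := (norm_nonneg _).trans (hS' 0 (by simp; linarith))
  -- The residual is at most `τ B`; the last two bounds give `2 τ B ≤ η` and `4 τ B S ≤ η²` for `η =
  -- y / 2`.
  refine ⟨min (y / 2) (min (y / (4 * B)) (y ^ 2 / (16 * B * (S + 1)))), by positivity,
    fun z hzK τ hτ hτε hτz => ?_⟩
  obtain ⟨h1, h2, h3⟩ := (le_min_iff.1 hτε).imp id le_min_iff.1
  rw [le_div_iff₀ (by positivity)] at h2 h3
  have hz : z ∈ upperHalf := show 0 < z.im by linarith
  have hw : z + -(Complex.I * τ) ∈ upperHalf := by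
    simp [upperHalf]
    linarith
  have hMB : ‖M z‖ ≤ B := by
    refine (hM.norm_le z hz).trans ?_
    rw [hB]
    gcongr
    linarith
  have hG : ‖P.eval (M z) - (z + -(Complex.I * τ)) * M z‖ ≤ τ * B := by
    have : P.eval (M z) - (z + -(Complex.I * τ)) * M z = Complex.I * τ * M z := by
      rw [hM.eval_eq z hz]; ring
    rw [this, norm_mul, norm_mul, Complex.norm_I, Complex.norm_real, Real.norm_of_nonneg hτ.le,
      one_mul]
    gcongr
  refine isInBasin_phiPoly_of_le (S := S) (η := y / 2) (ne_zero_of_mem_upperHalf hw)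
    (by positivity) ?_ (fun m hm => hS' m ?_) (by linarith) ?_
  · have h4 := hM.im_le_norm z hz
    have h5 : P.derivative.eval (M z) - z = P.derivative.eval (M z) - (z + -(Complex.I * τ)) +
        -(Complex.I * τ) := by ring
    have h6 := norm_add_le (P.derivative.eval (M z) - (z + -(Complex.I * τ))) (-(Complex.I * τ))
    rw [← h5, norm_neg, norm_mul, Complex.norm_I, Complex.norm_real, Real.norm_of_nonneg hτ.le,
      one_mul] at h6
    linarith
  · have h4 := norm_le_norm_add_norm_sub' m (M z)
    rw [Metric.mem_closedBall, dist_eq_norm] at hm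
    linarith
  · have h4 := mul_le_mul_of_nonneg_right hG hS0
    have h5 : 0 ≤ τ * B := by positivity
    nlinarith

/-! ### The loops -/

theorem exists_doublingLoop (hM : IsMasterBranch P M) {z : ℂ} (hz : z ∈ upperHalf) :
    ∃ z', DoublingLoop P X z z' := by
  obtain ⟨b, hb, hP⟩ := hM.eval_zero
  obtain ⟨d, hd⟩ := hM.derivative_eval_zero
  obtain ⟨S, hS⟩ := bddAbove_norm_eval_closedBall P.derivative.derivative 0 1
  have hS' : ∀ m ∈ Metric.closedBall (0 : ℂ) 1, ‖P.derivative.derivative.eval m‖ ≤ S :=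
    fun m hm => hS ⟨m, hm, rfl⟩
  have hS0 : 0 ≤ S := (norm_nonneg _).trans (hS' 0 (by simp))
  -- Ensures `2 b ≤ Im w` and `4 b S ≤ (b + S)² ≤ (Im w)²`.
  set K := 2 * b + 2 * S + 1 with hK
  have hbasin : ∀ w : ℂ, K ≤ w.im → IsInBasin (phiPoly P X w) 0 := fun w hw => by
    have hw0 : 0 < w.im := by linarith
    have hG : ‖P.eval 0 - w * 0‖ = b := by
      rw [hP, mul_zero, sub_zero, Complex.norm_real, Real.norm_of_nonneg hb.le]
    refine isInBasin_phiPoly_of_le (η := w.im)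
      (ne_zero_of_mem_upperHalf hw0) hw0 ?_ hS' (by rw [hG]; linarith) ?_
    · have := Complex.abs_im_le_norm (P.derivative.eval 0 - w)
      rw [hd, Complex.sub_im, Complex.ofReal_im, zero_sub, abs_neg, abs_of_pos hw0] at this
      rwa [hd]
    · rw [hG]
      nlinarith [sq_nonneg (b - S)]
  obtain ⟨n, hn⟩ := pow_unbounded_of_one_lt (K / z.im) one_lt_two
  rw [div_lt_iff₀ hz] at hn
  clear_value K
  clear hz
  induction n generalizing z with
  | zero => exact ⟨z, .exit z (hbasin z (by linarith))⟩
  | succ n ih =>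
    by_cases h : IsInBasin (phiPoly P X z) 0
    · exact ⟨z, .exit z h⟩
    · obtain ⟨z', hz'⟩ := @ih (z + Complex.I * (z.im : ℂ)) (by
        simp only [Complex.add_im, Complex.mul_im, Complex.I_re, Complex.I_im, Complex.ofReal_re,
          Complex.ofReal_im]
        rw [pow_succ] at hn
        linarith)
      exact ⟨z', .next z z' h hz'⟩

theorem _root_.DoublingLoop.spec {P Q : ℂ[X]} {z z' : ℂ} (h : DoublingLoop P Q z z')
    (hz : z ∈ upperHalf) : IsInBasin (phiPoly P Q z') 0 ∧ z'.re = z.re ∧ z.im ≤ z'.im := by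
  induction h with
  | exit z h => exact ⟨h, rfl, le_rfl⟩
  | next z z' _ _ ih =>
    have hz' : 0 < z.im := hz
    obtain ⟨h1, h2, h3⟩ := ih (by simp [upperHalf]; linarith)
    refine ⟨h1, by simpa using h2, ?_⟩
    simp at h3
    linarith

theorem _root_.HalvingLoop.spec {P Q : ℂ[X]} {z m dz dz' : ℂ} (h : HalvingLoop P Q z m dz dz')
    {τ : ℝ} (hτ : 0 < τ) (hdz : dz = -(Complex.I * τ)) :
    ∃ τ' : ℝ, 0 < τ' ∧ τ' ≤ τ ∧ dz' = -(Complex.I * τ') ∧ IsInBasin (phiPoly P Q (z + dz')) m := by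
  induction h generalizing τ with
  | exit dz h => exact ⟨τ, hτ, le_rfl, hdz, h⟩
  | next dz dz' _ _ ih =>
    obtain ⟨τ', h1, h2, h3⟩ := ih (half_pos hτ) (by rw [hdz]; push_cast; ring)
    exact ⟨τ', h1, by linarith, h3⟩

/-- A rejected step is longer than `ε`, so the accepted one is the full `τ` or longer than `ε / 2`.
This lower bound makes the main loop finite. -/
theorem _root_.exists_halvingLoop {P Q : ℂ[X]} {z m : ℂ} {ε τ : ℝ} (hε : 0 < ε) (hτ : 0 < τ)
    (h : ∀ s : ℝ, 0 < s → s ≤ ε → s ≤ τ → IsInBasin (phiPoly P Q (z + -(Complex.I * s))) m) :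
    ∃ τ' : ℝ, HalvingLoop P Q z m (-(Complex.I * τ)) (-(Complex.I * τ')) ∧
      0 < τ' ∧ τ' ≤ τ ∧ min τ (ε / 2) ≤ τ' := by
  obtain ⟨n, hn⟩ := pow_unbounded_of_one_lt (τ / ε) one_lt_two
  rw [div_lt_iff₀ hε] at hn
  induction n generalizing τ with
  | zero => exact ⟨τ, .exit _ (h τ hτ (by linarith) le_rfl), hτ, le_rfl, min_le_left _ _⟩
  | succ n ih =>
    by_cases hb : IsInBasin (phiPoly P Q (z + -(Complex.I * τ))) m
    · exact ⟨τ, .exit _ hb, hτ, le_rfl, min_le_left _ _⟩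
    · have hτε : ε < τ := by
        by_contra! hle
        exact hb (h τ hτ hle le_rfl)
      obtain ⟨τ', h1, h2, h3, h4⟩ := ih (half_pos hτ)
        (fun s hs hsε hsτ => h s hs hsε (by linarith)) (by rw [pow_succ] at hn; linarith)
      refine ⟨τ', .next _ _ hb ?_, h2, by linarith, ?_⟩
      · convert h1 using 1
        push_cast
        ring
      · rw [min_eq_right (by linarith)] at h4
        exact (min_le_right _ _).trans h4

theorem _root_.sub_eq_neg_I_mul {z w : ℂ} (h : z.re = w.re) :
    w - z = -(Complex.I * (z.im - w.im : ℝ)) := by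
  apply Complex.ext <;> simp [h]

theorem dichotomyLoop (hM : IsMasterBranch P M) {w z : ℂ} (hw : w ∈ upperHalf)
    (hre : z.re = w.re) (him : w.im ≤ z.im) : DichotomyLoop P X w z (M z) (M w) := by
  have hw' : 0 < w.im := hw
  obtain ⟨ε, hε, hstep⟩ := hM.exists_step (K := |w.re| + z.im) hw'
  -- `K` is fixed at the initial height: later points are lower, so one `ε` serves the whole run.
  generalize hKz : |w.re| + z.im = K at hstep
  replace hKz : |w.re| + z.im ≤ K := hKz.le
  obtain ⟨n, hn⟩ := exists_nat_ge ((z.im - w.im) / (ε / 2))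
  rw [div_le_iff₀ (by positivity)] at hn
  induction n generalizing z with
  | zero =>
    have : z = w := Complex.ext hre (by push_cast at hn; linarith)
    rw [this]
    exact .exit _
  | succ n ih =>
    rcases eq_or_ne z w with rfl | hne
    · exact .exit _
    have hz : z ∈ upperHalf := hw'.trans_le him
    have hτ : 0 < z.im - w.im := sub_pos.2 (lt_of_le_of_ne him fun h => hne (Complex.ext hre h.symm))
    have hzK : ‖z‖ ≤ K := by
      refine (Complex.norm_le_abs_re_add_abs_im z).trans ?_
      rwa [hre, abs_of_pos (hw'.trans_le him)]
    obtain ⟨τ, h1, h2, h3, h4⟩ := exists_halvingLoop (P := P) (Q := X) (z := z) (m := M z) hε hτ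
      fun s hs hsε hsτ => hstep z hzK s hs hsε (by linarith)
    rw [← sub_eq_neg_I_mul hre] at h1
    obtain ⟨τ', -, -, heq, hbasin⟩ := h1.spec hτ (sub_eq_neg_I_mul hre)
    refine .next z (M z) _ _ _ hne h1
      (hM.newtonReturns_vertical hz h2 (by linarith) hbasin) ?_
    have hzim : (z + -(Complex.I * τ)).im = z.im - τ := by simp [sub_eq_add_neg]
    refine ih (by simpa using hre) (by rw [hzim]; linarith) (by rw [hzim]; linarith) ?_
    rw [hzim]
    push_cast at hn
    have hn0 : 0 ≤ (n : ℝ) * (ε / 2) := by positivity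
    rcases min_le_iff.1 h4 with h5 | h5 <;> linarith

theorem eq_of_newtonReturns {p : ℂ[X]} {c m m' : ℂ} (h : NewtonReturns p c m)
    (h' : NewtonReturns p c m') : m = m' :=
  tendsto_nhds_unique h.2 h'.2

/-- The loop invariant is `m = M z`, preserved because Newton limits are unique. -/
theorem eq_of_dichotomyLoop (hM : IsMasterBranch P M) {w z m out : ℂ} (hw : w ∈ upperHalf)
    (h : DichotomyLoop P X w z m out) (hre : z.re = w.re) (him : w.im ≤ z.im)
    (hm : m = M z) : out = M w := by
  have hw' : 0 < w.im := hw
  induction h with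
  | exit m => exact hm
  | next z m dz m' out hne hhalf hnew _ ih =>
    have hz : z ∈ upperHalf := hw'.trans_le him
    have hτ : 0 < z.im - w.im := sub_pos.2 (lt_of_le_of_ne him fun h => hne (Complex.ext hre h.symm))
    obtain ⟨τ, h1, h2, rfl, hbasin⟩ := hhalf.spec hτ (sub_eq_neg_I_mul hre)
    subst hm
    refine ih (by simpa using hre) (by simp; linarith) (eq_of_newtonReturns hnew ?_)
    exact hM.newtonReturns_vertical hz h1 (by linarith) hbasin

theorem newtonLilypads_iff (hM : IsMasterBranch P M) {z : ℂ} (hz : z ∈ upperHalf) (out : ℂ) :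
    NewtonLilypads P X z none out ↔ out = M z := by
  have hz' : 0 < z.im := hz
  constructor
  · rintro ⟨z₀, m, hdoub, hnew, hdich⟩
    obtain ⟨h1, h2, h3⟩ := hdoub.spec hz
    exact hM.eq_of_dichotomyLoop hz hdich h2 h3
      (eq_of_newtonReturns hnew (hM.newtonReturns_zero (hz'.trans_le h3) h1))
  · rintro rfl
    obtain ⟨z₀, hdoub⟩ := hM.exists_doublingLoop hz
    obtain ⟨h1, h2, h3⟩ := hdoub.spec hz
    exact ⟨z₀, M z₀, hdoub, hM.newtonReturns_zero (hz'.trans_le h3) h1, hM.dichotomyLoop hz h2 h3⟩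

end IsMasterBranch

theorem mainTheorem3 (L : ℕ) (σ c lam : Fin L → ℝ)
    (hσ : ∀ l, 0 < σ l) (hc : ∀ l, 0 < c l) (hlam : ∀ l, 0 < lam l)
    (ν : Measure ℝ) [IsProbabilityMeasure ν] (hν : ν (Set.Iio 0) = 0)
    (hf : IsMomentGenInverse ν (masterFun σ c lam)) :
    IsHolomorphicInverse (masterFun σ c lam) (momentGen ν) ∧
    (∀ g : ℂ → ℂ, IsHolomorphicInverse (masterFun σ c lam) g →
      Set.EqOn g (momentGen ν) upperHalf) ∧
    ∀ z ∈ upperHalf, ∀ out : ℂ,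
      NewtonLilypads (masterNum σ c lam) X z none out ↔ out = momentGen ν z := by
  obtain ⟨b, hb, hP⟩ := masterNum_eval_zero (lam := lam) hσ hc
  obtain ⟨d, hd⟩ := masterNum_derivative_eval_zero σ c lam
  have hfun : masterFun σ c lam = fun m => (masterNum σ c lam).eval m / m := by
    funext m
    rw [masterFun_eq, eval_X]
  rw [hfun] at hf ⊢
  have hM := isMasterBranch_momentGen hb hP hd ν hν hf
  refine ⟨⟨differentiableOn_momentGen ν, hf.mono fun m hm _ => hm⟩, fun g hg => ?_,
    fun z hz out => hM.newtonLilypads_iff hz out⟩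
  have h := eqOn_zero_of_comp_eq_zero hb hP (hg.1.sub (differentiableOn_momentGen ν)) (by
    filter_upwards [hf, hg.2] with m h1 h2 h3
    rw [Pi.sub_apply, h1, h2 h3, sub_self])
  exact fun z hz => sub_eq_zero.1 (h hz)
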